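/- Consider the eigenvalue problem $-u^{(6)}(x)=\lambda\,u(x)$ for $x\in[0,1]$, with $u(0)=u'(0)=u''(0)=0$ and $u(1)=u'(1)=u''(1)=0$. Its eigenvalues (the $\lambda\in\mathbb{C}$ for which there is a solution $u:[0,1]\to\mathbb{C}$ of class $C^6$ that is not identically zero) are real, positive and simple (the space of solutions has dimension one), and they form a strictly increasing sequence $\{\lambda_{n,3}\}_{n=2}^\infty$, indexed so that $\lambda_{2,3}$ is the smallest eigenvalue, with \[\lambda_{n,3}=(n\pi)^6\quad\text{if } n\ge 2 \text{ is even}\] and \[\lambda_{n,3}=(n\pi+\delta_n)^6\quad\text{if } n\ge 3 \text{ is odd},\] where the $\delta_n$ are nonzero real numbers with $n\pi+\delta_n>0$ and \[\delta_n\sim 8\,(-1)^{\lfloor n/2\rfloor+1}e^{-(\pi\sqrt3/2)n}\quad\text{as } n\to\infty \text{ through the odd integers}\] (that is, the quotient of the two sides tends to $1$). In particular, if $\mu_{n,3}=\sqrt[6]{\lambda_{n,3}}$ denotes the positive sixth root, then for $n\ge 2$ one has $\mu_{n,3}=n\pi$ if and only if $n$ is even. -/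

import Mathlib

open Set Filter Topology

/-- `u` is a (complex-valued, classical) solution on `[0,1]` of
`(-1)^α u^(2α) = z u`, `u^(k)(0) = u^(k)(1) = 0` for `0 ≤ k ≤ α - 1`.
Derivatives are taken within `[0,1]` (one-sided at the endpoints), so that only the values of
`u` on `[0,1]` matter. -/
structure IsSolution (α : ℕ) (z : ℂ) (u : ℝ → ℂ) : Prop where
  contDiffOn : ContDiffOn ℝ ((2 * α : ℕ) : WithTop ℕ∞) u (Icc 0 1)
  ode : ∀ x ∈ Icc (0 : ℝ) 1,
    (-1 : ℂ) ^ α * iteratedDerivWithin (2 * α) u (Icc 0 1) x = z * u x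
  left : ∀ k < α, iteratedDerivWithin k u (Icc 0 1) 0 = 0
  right : ∀ k < α, iteratedDerivWithin k u (Icc 0 1) 1 = 0

theorem IsSolution.zero (α : ℕ) (z : ℂ) : IsSolution α z 0 where
  contDiffOn := contDiffOn_const
  ode x _ := by simp
  left k _ := by simp
  right k _ := by simp

theorem IsSolution.add {α : ℕ} {z : ℂ} {u v : ℝ → ℂ}
    (hu : IsSolution α z u) (hv : IsSolution α z v) : IsSolution α z (u + v) := by
  have key : ∀ k ≤ 2 * α, ∀ x ∈ Icc (0 : ℝ) 1,
      iteratedDerivWithin k (u + v) (Icc 0 1) x =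
        iteratedDerivWithin k u (Icc 0 1) x + iteratedDerivWithin k v (Icc 0 1) x := by
    intro k hk x hx
    have hk' : ((k : ℕ) : WithTop ℕ∞) ≤ ((2 * α : ℕ) : WithTop ℕ∞) := by exact_mod_cast hk
    exact iteratedDerivWithin_add hx (uniqueDiffOn_Icc zero_lt_one)
      ((hu.contDiffOn x hx).of_le hk') ((hv.contDiffOn x hx).of_le hk')
  refine ⟨hu.contDiffOn.add hv.contDiffOn, fun x hx => ?_, fun k hk => ?_, fun k hk => ?_⟩
  · rw [key _ le_rfl x hx, mul_add, hu.ode x hx, hv.ode x hx, Pi.add_apply, mul_add]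
  · rw [key k (by omega) 0 (by simp), hu.left k hk, hv.left k hk, add_zero]
  · rw [key k (by omega) 1 (by simp), hu.right k hk, hv.right k hk, add_zero]

theorem IsSolution.smul {α : ℕ} {z : ℂ} {u : ℝ → ℂ} (c : ℂ)
    (hu : IsSolution α z u) : IsSolution α z (c • u) := by
  refine ⟨hu.contDiffOn.const_smul c, fun x hx => ?_, fun k hk => ?_, fun k hk => ?_⟩
  · rw [iteratedDerivWithin_const_smul_field, smul_eq_mul, mul_left_comm, hu.ode x hx,
      Pi.smul_apply, smul_eq_mul, mul_left_comm]
  · rw [iteratedDerivWithin_const_smul_field, hu.left k hk, smul_zero]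
  · rw [iteratedDerivWithin_const_smul_field, hu.right k hk, smul_zero]

/-- The space of solutions for the parameter `z`, as functions on `[0,1]`. The number `z` is an
eigenvalue if and only if this space is nonzero, and then its dimension is the multiplicity. -/
def eigenspace (α : ℕ) (z : ℂ) : Submodule ℂ (Icc (0 : ℝ) 1 → ℂ) where
  carrier := {v | ∃ u : ℝ → ℂ, IsSolution α z u ∧ ∀ x : Icc (0 : ℝ) 1, v x = u x}
  zero_mem' := ⟨0, IsSolution.zero α z, fun _ => rfl⟩
  add_mem' := by
    rintro v w ⟨u, hu, huv⟩ ⟨t, ht, htw⟩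
    exact ⟨u + t, hu.add ht, fun x => by simp [huv x, htw x]⟩
  smul_mem' := by
    rintro c v ⟨u, hu, huv⟩
    exact ⟨c • u, hu.smul c, fun x => by simp [huv x]⟩

/-- `lam n₀ ≤ lam (n₀ + 1) ≤ …` lists all the (complex) eigenvalues in increasing order, each
one as many times as its multiplicity. (A number that is not an eigenvalue is listed
`0` times; the values `lam n` with `n < n₀` are irrelevant.) -/
structure IsEigenvalueSequence (α n₀ : ℕ) (lam : ℕ → ℝ) : Prop where
  monotoneOn : MonotoneOn lam (Ici n₀)
  count : ∀ z : ℂ, {n : ℕ | n₀ ≤ n ∧ (lam n : ℂ) = z}.encard =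
    Cardinal.toENat (Module.rank ℂ (eigenspace α z))

/-! Pairing the equation with the conjugate of `u` and integrating by parts gives `∫ |u'''|² = λ ∫
|u|²`, so every eigenvalue is positive and equals `w ^ 6` with `w > 0`
(`IsSolution.exists_pos_of_ne_zero`). The characteristic exponents are then `± r_k` with `r_k = i w
ρ ^ k`, `ρ` a primitive cube root of unity. Reflection about the midpoint splits the boundary
problem into two 3×3 blocks `charMatrix w (± 1)`. The right kernel of a block contains the endpoint
data of every solution (`IsSolution.charMatrix_mulVec`); its left kernel supplies coefficients of
exponential solutions (`isSolution_expSum`). Hence `w ^ 6` is an eigenvalue iff one block is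
singular.

Because `r_0 + r_1 + r_2 = 0`, addition formulas collapse the determinants. With `θ = w / 2`, one
block is singular iff `sin θ = 0`, the other iff `cos θ (cos θ + cosh (√3 θ)) = 2`. The first
equation gives `w = n π` with `n` even. The second has no root in `(0, π)` (`cos_mul_lt_two`) and
one in each later interval between multiples of `π`, exponentially close to its midpoint since a
small cosine must balance a huge cosh. The blocks are never singular together, and a singular one
has a one-dimensional kernel, so all eigenvalues are simple. -/

/-! ### Real roots of the odd characteristic equation -/

/-- The function `y ↦ sin y (sin y + cosh (√3 (a + σ y)))`. For `a = n π / 2` with `n` odd and the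
right sign `σ`, it is `cos θ (cos θ + cosh (√3 θ))` at `θ = a + σ y`. -/
noncomputable def oddChar (a σ y : ℝ) : ℝ :=
  Real.sin y * (Real.sin y + Real.cosh (√3 * (a + σ * y)))

theorem continuous_oddChar (a σ : ℝ) : Continuous (oddChar a σ) := by
  unfold oddChar
  fun_prop

theorem hasDerivAt_oddChar (a σ y : ℝ) :
    HasDerivAt (oddChar a σ)
      (Real.cos y * (Real.sin y + Real.cosh (√3 * (a + σ * y))) +
        Real.sin y * (Real.cos y + Real.sinh (√3 * (a + σ * y)) * (√3 * σ))) y := by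
  have h1 : HasDerivAt (fun y : ℝ => √3 * (a + σ * y)) (√3 * σ) y := by
    simpa using (((hasDerivAt_id y).const_mul σ).const_add a).const_mul (√3)
  exact (Real.hasDerivAt_sin y).mul ((Real.hasDerivAt_sin y).add h1.cosh)

/-- The bound `π / 6` is where `√3 sin y = cos y`. Up to there `cos y · cosh` dominates the possibly
negative term `√3 σ sin y · sinh`, because `|sinh| ≤ cosh`. -/
theorem strictMonoOn_oddChar (a : ℝ) {σ : ℝ} (hσ : σ = 1 ∨ σ = -1) :
    StrictMonoOn (oddChar a σ) (Icc 0 (Real.pi / 6)) := by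
  refine strictMonoOn_of_deriv_pos (convex_Icc _ _) (continuous_oddChar a σ).continuousOn ?_
  intro y hy
  rw [interior_Icc] at hy
  rw [(hasDerivAt_oddChar a σ y).deriv]
  have hpi := Real.pi_pos
  have hs0 : 0 < Real.sin y := Real.sin_pos_of_pos_of_lt_pi hy.1 (by linarith [hy.2])
  have hs : Real.sin y ≤ 1 / 2 := by
    rw [← Real.sin_pi_div_six]
    exact Real.sin_le_sin_of_le_of_le_pi_div_two (by linarith [hy.1]) (by linarith) hy.2.le
  have hc : √3 / 2 ≤ Real.cos y := by
    rw [← Real.cos_pi_div_six]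
    exact Real.cos_le_cos_of_nonneg_of_le_pi hy.1.le (by linarith) hy.2.le
  have h3 : 0 < √3 := by positivity
  have hc0 : 0 < Real.cos y := by linarith
  have hsc : √3 * Real.sin y ≤ Real.cos y := by nlinarith
  set x := √3 * (a + σ * y)
  have hch := Real.cosh_pos x
  have habs : 0 ≤ Real.cosh x + σ * Real.sinh x ∧ 0 ≤ Real.cosh x - σ * Real.sinh x := by
    have e1 := Real.exp_pos x
    have e2 := Real.exp_pos (-x)
    rw [← Real.cosh_add_sinh] at e1
    rw [← Real.cosh_sub_sinh] at e2
    rcases hσ with h | h <;> rw [h] <;> constructor <;> linarith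
  nlinarith [mul_pos hs0 hc0, mul_nonneg (sub_nonneg.2 hsc) hch.le,
    mul_nonneg (mul_pos h3 hs0).le habs.1]

theorem two_lt_oddChar {a σ y : ℝ} (ha : 3 * Real.pi / 2 ≤ a) (hσ : σ = 1 ∨ σ = -1)
    (hy : Real.pi / 6 ≤ y) (hy' : y ≤ Real.pi / 2) : 2 < oddChar a σ y := by
  have hpi := Real.pi_gt_three
  have hs : 1 / 2 ≤ Real.sin y := by
    rw [← Real.sin_pi_div_six]
    exact Real.sin_le_sin_of_le_of_le_pi_div_two (by linarith) hy' hy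
  have hx : 3 ≤ a + σ * y := by rcases hσ with h | h <;> rw [h] <;> linarith
  have hch : 4 < Real.cosh (√3 * (a + σ * y)) := by
    have h3 : 1 ≤ √3 := by rw [Real.one_le_sqrt]; norm_num
    have h4 : 3 ≤ √3 * (a + σ * y) := by nlinarith
    have := Real.quadratic_le_exp_of_nonneg (by linarith : 0 ≤ √3 * (a + σ * y))
    rw [Real.cosh_eq]
    nlinarith [Real.exp_pos (-(√3 * (a + σ * y)))]
  unfold oddChar
  nlinarith

theorem exists_oddChar_eq_two {a σ : ℝ} (ha : 3 * Real.pi / 2 ≤ a) (hσ : σ = 1 ∨ σ = -1) :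
    ∃ y ∈ Ioo 0 (Real.pi / 6), oddChar a σ y = 2 := by
  have hpi := Real.pi_pos
  have h0 : oddChar a σ 0 = 0 := by simp [oddChar]
  have h1 := two_lt_oddChar ha hσ le_rfl (by linarith)
  have := intermediate_value_Ioo (by positivity : (0 : ℝ) ≤ Real.pi / 6)
    (continuous_oddChar a σ).continuousOn
  obtain ⟨y, hy, h⟩ := this ⟨by rw [h0]; norm_num, h1⟩
  exact ⟨y, hy, h⟩

theorem oddChar_eq_two_unique {a σ y y' : ℝ} (ha : 3 * Real.pi / 2 ≤ a) (hσ : σ = 1 ∨ σ = -1)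
    (hy : y ∈ Ioc 0 (Real.pi / 2)) (hy' : y' ∈ Ioc 0 (Real.pi / 2))
    (h : oddChar a σ y = 2) (h' : oddChar a σ y' = 2) : y = y' := by
  have key : ∀ t ∈ Ioc 0 (Real.pi / 2), oddChar a σ t = 2 → t ∈ Icc 0 (Real.pi / 6) := by
    intro t ht h
    refine ⟨ht.1.le, ?_⟩
    by_contra! hlt
    exact (two_lt_oddChar ha hσ hlt.le ht.2).ne' h
  exact (strictMonoOn_oddChar a hσ).injOn (key y hy h) (key y' hy' h') (h.trans h'.symm)

theorem tendsto_of_oddChar_eq_two {ι : Type*} {l : Filter ι} {a σ y : ι → ℝ}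
    (ha : Tendsto a l atTop) (hσ : ∀ᶠ i in l, σ i = 1 ∨ σ i = -1)
    (hy : ∀ᶠ i in l, y i ∈ Ioo 0 (Real.pi / 6)) (h : ∀ᶠ i in l, oddChar (a i) (σ i) (y i) = 2) :
    Tendsto (fun i => y i * Real.exp (√3 * a i) / 4) l (𝓝 1) := by
  have hpi := Real.pi_gt_three
  have hpi' := Real.pi_lt_four
  have h3 : 1 ≤ √3 := by rw [Real.one_le_sqrt]; norm_num
  -- A crude bound is enough at first: cosh grows at least linearly, so the equation forces `y ≤ 8 /
  -- (a - 1)`.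
  have hy0 : Tendsto y l (𝓝 0) := by
    have hlim : Tendsto (fun i => 8 * (a i - 1)⁻¹) l (𝓝 0) := by
      simpa [Function.comp_def, sub_eq_add_neg] using (tendsto_inv_atTop_zero.comp
        (tendsto_atTop_add_const_right l (-1) ha)).const_mul 8
    refine tendsto_of_tendsto_of_tendsto_of_le_of_le' tendsto_const_nhds hlim ?_ ?_
    · filter_upwards [hy] with i hi using hi.1.le
    · filter_upwards [hy, h, hσ, ha.eventually_ge_atTop 2] with i hi hh hs hai
      have hx : a i - 1 ≤ a i + σ i * y i := by
        rcases hs with h | h <;> rw [h] <;> linarith [hi.1, hi.2]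
      have hch : a i - 1 ≤ 2 * Real.cosh (√3 * (a i + σ i * y i)) := by
        have e1 := Real.add_one_le_exp (√3 * (a i + σ i * y i))
        have e2 := Real.exp_pos (-(√3 * (a i + σ i * y i)))
        rw [Real.cosh_eq]
        nlinarith
      have hsin := Real.mul_le_sin hi.1.le (by linarith [hi.2])
      have hsin' : y i / 2 ≤ Real.sin (y i) := by
        refine le_trans ?_ hsin
        rw [div_mul_eq_mul_div, div_le_div_iff₀ (by norm_num) (by linarith)]
        nlinarith [hi.1]
      rw [← div_eq_mul_inv, le_div_iff₀ (by linarith)]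
      unfold oddChar at hh
      have hs0 : 0 < Real.sin (y i) := by linarith [hi.1]
      nlinarith [mul_le_mul_of_nonneg_left hch hs0.le,
        mul_le_mul_of_nonneg_right hsin' (by linarith : 0 ≤ a i - 1)]
  have hσy : Tendsto (fun i => σ i * y i) l (𝓝 0) := by
    rw [tendsto_zero_iff_abs_tendsto_zero]
    refine (tendsto_zero_iff_abs_tendsto_zero _ |>.1 hy0).congr' ?_
    filter_upwards [hσ] with i hi
    rcases hi with h | h <;> simp [h]
  have hexp : Tendsto (fun i => Real.exp (-(√3 * a i))) l (𝓝 0) :=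
    Real.tendsto_exp_neg_atTop_nhds_zero.comp (ha.const_mul_atTop (by positivity))
  have hsinc : Tendsto (fun i => Real.sinc (y i)) l (𝓝 1) := by
    have := Real.continuous_sinc.tendsto 0
    rw [Real.sinc_zero] at this
    exact this.comp hy0
  have hsin : Tendsto (fun i => Real.sin (y i)) l (𝓝 0) := by
    have := Real.continuous_sin.tendsto 0
    rw [Real.sin_zero] at this
    exact this.comp hy0
  have hE : Tendsto (fun i => Real.exp (√3 * (σ i * y i))) l (𝓝 1) := by
    have := (Real.continuous_exp.tendsto (√3 * 0)).comp (hσy.const_mul (√3))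
    simpa [Function.comp_def] using this
  have hE' : Tendsto (fun i => Real.exp (-(√3 * (σ i * y i)))) l (𝓝 1) := by
    have := (Real.continuous_exp.tendsto (-(√3 * 0))).comp (hσy.const_mul (√3)).neg
    simpa [Function.comp_def] using this
  -- Solving the equation for `y * exp (√3 a) / 4` gives exactly the reciprocal of this expression.
  -- Since `y → 0`, the shift `σ y` inside cosh only contributes a factor tending to 1.
  have hden : Tendsto (fun i => Real.sinc (y i) * (2 * Real.exp (-(√3 * a i)) * Real.sin (y i) +
      (Real.exp (√3 * (σ i * y i)) +
        Real.exp (-(√3 * a i)) ^ 2 * Real.exp (-(√3 * (σ i * y i)))))) l (𝓝 1) := by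
    have := hsinc.mul (((hexp.const_mul 2).mul hsin).add (hE.add ((hexp.pow 2).mul hE')))
    simpa using this
  have := hden.inv₀ one_ne_zero
  rw [inv_one] at this
  refine this.congr' ?_
  filter_upwards [hy, h] with i hi hh
  have hs0 : 0 < Real.sin (y i) :=
    Real.sin_pos_of_pos_of_lt_pi hi.1 (by linarith [hi.2])
  have hy1 := hi.1
  rw [Real.sinc_of_ne_zero hi.1.ne']
  unfold oddChar at hh
  rw [Real.cosh_eq, mul_add (√3), neg_add, Real.exp_add, Real.exp_add] at hh
  have he : Real.exp (√3 * a i) * Real.exp (-(√3 * a i)) = 1 := by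
    rw [← Real.exp_add]; simp
  set A := Real.exp (√3 * a i)
  set B := Real.exp (-(√3 * a i))
  set P := Real.exp (√3 * (σ i * y i))
  set Q := Real.exp (-(√3 * (σ i * y i)))
  have hA : 0 < A := Real.exp_pos _
  have hB : B ≠ 0 := (Real.exp_pos _).ne'
  rw [inv_eq_of_mul_eq_one_left]
  field_simp
  linear_combination 2 * hh + Real.sin (y i) * (2 * Real.sin (y i) + B * Q) * he

/-- No zero of the odd characteristic function lies in `(0, π)`. -/
theorem cos_mul_lt_two {θ : ℝ} (h0 : 0 < θ) (hpi : θ < Real.pi) :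
    Real.cos θ * (Real.cos θ + Real.cosh (√3 * θ)) < 2 := by
  have h3 : √3 * √3 = 3 := Real.mul_self_sqrt (by norm_num)
  have lin : ∀ x : ℝ, HasDerivAt (fun x : ℝ => √3 * x) (√3) x := fun x => by
    simpa using (hasDerivAt_id x).const_mul (√3)
  -- The function minus 2 and its first two derivatives vanish at 0, and the third is `-8 sin x
  -- (cosh (√3 x) - cos x) < 0`; negativity is passed down one derivative at a time.
  have anti : ∀ f f' : ℝ → ℝ, (∀ x, HasDerivAt f (f' x) x) → f 0 = 0 →
      (∀ x ∈ Ioo 0 Real.pi, f' x < 0) → ∀ x ∈ Ioo 0 Real.pi, f x < 0 := by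
    intro f f' hf hf0 hneg x hx
    have : StrictAntiOn f (Icc 0 Real.pi) := by
      refine strictAntiOn_of_deriv_neg (convex_Icc _ _)
        (fun x _ => (hf x).continuousAt.continuousWithinAt) fun x hx => ?_
      rw [interior_Icc] at hx
      rw [(hf x).deriv]
      exact hneg x hx
    rw [← hf0]
    exact this ⟨le_rfl, hx.1.le.trans hx.2.le⟩ ⟨hx.1.le, hx.2.le⟩ hx.1
  have d3 : ∀ x ∈ Ioo 0 Real.pi,
      -8 * Real.sin x * (Real.cosh (√3 * x) - Real.cos x) < 0 := by
    intro x hx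
    have hs := Real.sin_pos_of_pos_of_lt_pi hx.1 hx.2
    have hc : 1 < Real.cosh (√3 * x) := Real.one_lt_cosh.2 (by have := hx.1; positivity)
    have := mul_pos hs (sub_pos.2 ((Real.cos_le_one x).trans_lt hc))
    linarith
  have d2 := anti (fun x => 2 * (Real.cos x * Real.cosh (√3 * x) -
      √3 * (Real.sin x * Real.sinh (√3 * x)) - (2 * Real.cos x ^ 2 - 1))) _ (fun x => by
    have h1 := ((Real.hasDerivAt_cos x).mul (lin x).cosh).sub
      (((Real.hasDerivAt_sin x).mul (lin x).sinh).const_mul (√3))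
    have h2 := (((Real.hasDerivAt_cos x).pow 2).const_mul 2).sub_const 1
    have := (h1.sub h2).const_mul 2
    refine this.congr_deriv (g' := -8 * Real.sin x * (Real.cosh (√3 * x) - Real.cos x)) ?_
    simp only [Nat.cast_ofNat]
    linear_combination (-2 * Real.sin x * Real.cosh (√3 * x)) * h3) (by simp; norm_num) d3
  have d1 := anti (fun x => -Real.sin x * Real.cosh (√3 * x) +
      √3 * (Real.cos x * Real.sinh (√3 * x)) - 2 * Real.sin x * Real.cos x) _ (fun x => by
    have h1 := (((Real.hasDerivAt_sin x).neg).mul (lin x).cosh).add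
      (((Real.hasDerivAt_cos x).mul (lin x).sinh).const_mul (√3))
    have h2 := ((Real.hasDerivAt_sin x).const_mul 2).mul (Real.hasDerivAt_cos x)
    refine (h1.sub h2).congr_deriv ?_
    simp only [Pi.neg_apply]
    linear_combination (Real.cos x * Real.cosh (√3 * x)) * h3 +
      2 * Real.sin_sq_add_cos_sq x) (by simp) d2
  have d0 := anti (fun x => Real.cos x * (Real.cos x + Real.cosh (√3 * x)) - 2) _ (fun x => by
    have h1 := (Real.hasDerivAt_cos x).mul ((Real.hasDerivAt_cos x).add (lin x).cosh)
    refine (h1.sub_const 2).congr_deriv ?_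
    simp only [Pi.add_apply]
    ring) (by simp; norm_num) d1
  have := d0 θ ⟨h0, hpi⟩
  linarith

theorem cos_add_half_pi (m : ℕ) (y : ℝ) :
    Real.cos (((2 * m + 1 : ℕ) : ℝ) * Real.pi / 2 + (-1) ^ (m + 1) * y) = Real.sin y := by
  have : ((2 * m + 1 : ℕ) : ℝ) * Real.pi / 2 + (-1) ^ (m + 1) * y =
      (Real.pi / 2 + (-1) ^ (m + 1) * y) + m * Real.pi := by push_cast; ring
  rw [this, Real.cos_add_nat_mul_pi, add_comm, Real.cos_add_pi_div_two]
  rcases Nat.even_or_odd m with h | h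
  · simp [pow_succ, h.neg_one_pow]
  · simp [pow_succ, h.neg_one_pow]

theorem oddChar_eq (m : ℕ) (y : ℝ) :
    oddChar (((2 * m + 1 : ℕ) : ℝ) * Real.pi / 2) ((-1) ^ (m + 1)) y =
      Real.cos (((2 * m + 1 : ℕ) : ℝ) * Real.pi / 2 + (-1) ^ (m + 1) * y) *
      (Real.cos (((2 * m + 1 : ℕ) : ℝ) * Real.pi / 2 + (-1) ^ (m + 1) * y) +
        Real.cosh (√3 * (((2 * m + 1 : ℕ) : ℝ) * Real.pi / 2 + (-1) ^ (m + 1) * y))) := by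
  rw [cos_add_half_pi, oddChar]

theorem exists_eq_of_cos_mul_eq_two {θ : ℝ} (h0 : 0 < θ)
    (h : Real.cos θ * (Real.cos θ + Real.cosh (√3 * θ)) = 2) :
    ∃ m : ℕ, 1 ≤ m ∧ ∃ y ∈ Ioc 0 (Real.pi / 2),
      θ = ((2 * m + 1 : ℕ) : ℝ) * Real.pi / 2 + (-1) ^ (m + 1) * y := by
  have hpi := Real.pi_pos
  have hθ : Real.pi ≤ θ := by
    by_contra! hlt
    exact (cos_mul_lt_two h0 hlt).ne h
  have hcos : 0 < Real.cos θ := by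
    have h1 : 0 ≤ Real.cos θ + Real.cosh (√3 * θ) := by
      linarith [Real.one_le_cosh (√3 * θ), Real.neg_one_le_cos θ]
    by_contra! hle
    linarith [mul_nonpos_of_nonpos_of_nonneg hle h1]
  set m := ⌊θ / Real.pi⌋₊ with hm
  have hm1 : 1 ≤ m := Nat.le_floor (by rw [Nat.cast_one, le_div_iff₀ hpi]; linarith)
  have hlo : m * Real.pi ≤ θ := by
    rw [← le_div_iff₀ hpi]; exact Nat.floor_le (by positivity)
  have hhi : θ < (m + 1) * Real.pi := by
    rw [← div_lt_iff₀ hpi]; exact Nat.lt_floor_add_one _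
  have hc : Real.cos θ = (-1) ^ m * Real.cos (θ - m * Real.pi) := by
    rw [← Real.cos_add_nat_mul_pi, sub_add_cancel]
  -- Positivity of the cosine selects the left half of `[m π, (m + 1) π]` for even `m` and the right
  -- half for odd `m`; the sign makes the distance to the midpoint positive.
  refine ⟨m, hm1, (-1) ^ (m + 1) * (θ - m * Real.pi - Real.pi / 2), ?_, ?_⟩
  · rw [hc] at hcos
    rcases Nat.even_or_odd m with h | h
    · rw [h.neg_one_pow, one_mul] at hcos
      rw [pow_succ, h.neg_one_pow]
      have : θ - m * Real.pi < Real.pi / 2 := by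
        by_contra! hle
        linarith [Real.cos_nonpos_of_pi_div_two_le_of_le hle (by linarith)]
      constructor <;> linarith
    · rw [h.neg_one_pow] at hcos
      rw [pow_succ, h.neg_one_pow]
      have : Real.pi / 2 < θ - m * Real.pi := by
        by_contra! hle
        linarith [Real.cos_nonneg_of_neg_pi_div_two_le_of_le (by linarith) hle]
      constructor <;> linarith
  · rw [← mul_assoc, ← mul_pow]
    push_cast
    norm_num
    ring

/-! ### Regularity of solutions and positivity of eigenvalues -/

namespace IsSolution

theorem hasDerivWithinAt {α : ℕ} {z : ℂ} {u : ℝ → ℂ} (hu : IsSolution α z u) {m : ℕ}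
    (hm : m < 2 * α) {x : ℝ} (hx : x ∈ Icc (0 : ℝ) 1) :
    HasDerivWithinAt (iteratedDerivWithin m u (Icc 0 1))
      (iteratedDerivWithin (m + 1) u (Icc 0 1) x) (Icc 0 1) x := by
  rw [iteratedDerivWithin_succ]
  exact (hu.contDiffOn.differentiableOn_iteratedDerivWithin (by exact_mod_cast hm)
    (uniqueDiffOn_Icc zero_lt_one) x hx).hasDerivWithinAt

theorem continuousOn_iteratedDerivWithin {α : ℕ} {z : ℂ} {u : ℝ → ℂ} (hu : IsSolution α z u)
    {m : ℕ} (hm : m ≤ 2 * α) : ContinuousOn (iteratedDerivWithin m u (Icc 0 1)) (Icc 0 1) :=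
  hu.contDiffOn.continuousOn_iteratedDerivWithin (by exact_mod_cast hm)
    (uniqueDiffOn_Icc zero_lt_one)

end IsSolution

/-- A function on `[0,1]` with vanishing derivative is constant. -/
theorem eq_left_of_hasDerivWithinAt_zero {f : ℝ → ℂ}
    (hf : ∀ x ∈ Icc (0 : ℝ) 1, HasDerivWithinAt f 0 (Icc 0 1) x) {x : ℝ} (hx : x ∈ Icc (0 : ℝ) 1) :
    f x = f 0 := by
  refine constant_of_has_deriv_right_zero (fun x hx => (hf x hx).continuousWithinAt)
    (fun x hx => ?_) x hx
  exact (hf x ⟨hx.1, hx.2.le⟩).mono_of_mem_nhdsWithin (Icc_mem_nhdsGE_of_mem hx)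

section Positivity

open ComplexConjugate

theorem IsSolution.exists_pos_of_ne_zero {z : ℂ} {u : ℝ → ℂ} (hu : IsSolution 3 z u)
    (hne : ∃ x ∈ Icc (0 : ℝ) 1, u x ≠ 0) : ∃ t : ℝ, 0 < t ∧ z = t := by
  set U : ℕ → ℝ → ℂ := fun m => iteratedDerivWithin m u (Icc 0 1) with hU
  have hU0 : U 0 = u := iteratedDerivWithin_zero
  have hd : ∀ m < 6, ∀ x ∈ Icc (0 : ℝ) 1, HasDerivWithinAt (U m) (U (m + 1) x) (Icc 0 1) x :=
    fun m hm x hx => hu.hasDerivWithinAt (by omega) hx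
  have hc : ∀ m ≤ 6, ContinuousOn (U m) (Icc 0 1) :=
    fun m hm => hu.continuousOn_iteratedDerivWithin (by omega)
  have h6 : ∀ x ∈ Icc (0 : ℝ) 1, U 6 x = -(z * U 0 x) := by
    intro x hx
    have := hu.ode x hx
    rw [hU0, ← this]
    simp [hU]
    ring
  have hl : ∀ k < 3, U k 0 = 0 := hu.left
  have hr : ∀ k < 3, U k 1 = 0 := hu.right
  have hpos : ∀ m ≤ 6, (∃ x ∈ Icc (0 : ℝ) 1, U m x ≠ 0) →
      0 < ∫ x in (0 : ℝ)..1, Complex.normSq (U m x) := by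
    rintro m hm ⟨x, hx, h⟩
    exact intervalIntegral.integral_pos one_pos
      (Complex.continuous_normSq.comp_continuousOn (hc m hm))
      (fun _ _ => Complex.normSq_nonneg _) ⟨x, hx, Complex.normSq_pos.2 h⟩
  have p0 := hpos 0 (by norm_num) (by rwa [hU0])
  have hback : ∀ m < 3, (∀ x ∈ Icc (0 : ℝ) 1, U (m + 1) x = 0) →
      ∀ x ∈ Icc (0 : ℝ) 1, U m x = 0 := by
    intro m hm h x hx
    rw [eq_left_of_hasDerivWithinAt_zero (f := U m) (fun y hy => ?_) hx, hl m hm]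
    have := hd m (by omega) y hy
    rwa [h y hy] at this
  -- If `u'''` vanished identically, the three conditions at 0 would make `u` zero.
  have p3 := hpos 3 (by norm_num) (by
    by_contra! h
    obtain ⟨x, hx, hne⟩ := hne
    refine hne ?_
    rw [← hU0]
    exact hback 0 (by norm_num) (hback 1 (by norm_num) (hback 2 (by norm_num) h)) x hx)
  have hint : (∫ x in (0 : ℝ)..1, ((Complex.normSq (U 3 x) : ℂ) - z * Complex.normSq (U 0 x))) =
      0 := by
    -- The boundary expression of a triple integration by parts; each of its terms contains a factor
    -- of order at most 2, which vanishes at both endpoints.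
    have hW : ∀ x ∈ Icc (0 : ℝ) 1, HasDerivWithinAt
        (fun x => U 5 x * conj (U 0 x) - U 4 x * conj (U 1 x) + U 3 x * conj (U 2 x))
        ((Complex.normSq (U 3 x) : ℂ) - z * Complex.normSq (U 0 x)) (Icc 0 1) x := by
      intro x hx
      have h0 := (hd 0 (by norm_num) x hx).star
      have h1 := (hd 1 (by norm_num) x hx).star
      have h2 := (hd 2 (by norm_num) x hx).star
      have h3 := hd 3 (by norm_num) x hx
      have h4 := hd 4 (by norm_num) x hx
      have h5 := hd 5 (by norm_num) x hx
      refine (((h5.mul h0).sub (h4.mul h1)).add (h3.mul h2)).congr_deriv ?_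
      simp only [Nat.reduceAdd, h6 x hx, ← Complex.mul_conj, Complex.star_def]
      ring
    rw [intervalIntegral.integral_eq_sub_of_hasDeriv_right_of_le zero_le_one
      (fun x hx => (hW x hx).continuousWithinAt)
      (fun x hx => (hW x ⟨hx.1.le, hx.2.le⟩).mono_of_mem_nhdsWithin
        (Filter.mem_of_superset (Ioc_mem_nhdsGT hx.2) fun y hy => ⟨hx.1.le.trans hy.1.le, hy.2⟩))]
    · simp [hl, hr]
    · refine ContinuousOn.intervalIntegrable_of_Icc zero_le_one ?_
      have h0 := Complex.continuous_ofReal.comp_continuousOn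
        (Complex.continuous_normSq.comp_continuousOn (hc 0 (by norm_num)))
      have h3 := Complex.continuous_ofReal.comp_continuousOn
        (Complex.continuous_normSq.comp_continuousOn (hc 3 (by norm_num)))
      exact h3.sub (continuousOn_const.mul h0)
  have hi : ∀ m ≤ 6, IntervalIntegrable (fun x => (Complex.normSq (U m x) : ℂ))
      MeasureTheory.volume 0 1 := fun m hm =>
    ContinuousOn.intervalIntegrable_of_Icc zero_le_one (Complex.continuous_ofReal.comp_continuousOn
        (Complex.continuous_normSq.comp_continuousOn (hc m hm)))
  rw [intervalIntegral.integral_sub (hi 3 (by norm_num)) ((hi 0 (by norm_num)).const_mul z),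
    intervalIntegral.integral_const_mul, intervalIntegral.integral_ofReal,
    intervalIntegral.integral_ofReal] at hint
  refine ⟨_, div_pos p3 p0, ?_⟩
  rw [Complex.ofReal_div, eq_div_iff (by exact_mod_cast p0.ne')]
  linear_combination -hint

end Positivity

/-! ### Characteristic roots and the two symmetry blocks -/

/-- The primitive cube root of unity in the upper half-plane. -/
noncomputable def cubeRoot : ℂ := -1 / 2 + (√3 / 2 : ℝ) * Complex.I

theorem cubeRoot_sq_add : cubeRoot ^ 2 + cubeRoot + 1 = 0 := by
  have h : ((√3 / 2 : ℝ) : ℂ) ^ 2 = 3 / 4 := by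
    rw [← Complex.ofReal_pow, div_pow, Real.sq_sqrt (by norm_num)]
    norm_num
  unfold cubeRoot
  linear_combination ((√3 / 2 : ℝ) : ℂ) ^ 2 * Complex.I_sq - h

theorem cubeRoot_pow_three : cubeRoot ^ 3 = 1 := by
  linear_combination (cubeRoot - 1) * cubeRoot_sq_add

theorem cubeRoot_ne_zero : cubeRoot ≠ 0 := by
  intro h
  simpa [h] using cubeRoot_pow_three

theorem cubeRoot_ne_one : cubeRoot ≠ 1 := by
  intro h
  have := cubeRoot_sq_add
  rw [h] at this
  norm_num at this

/-- Half of the characteristic roots `i w ρ ^ k` of `-u⁽⁶⁾ = w ^ 6 u`. The other half are the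
negatives of these. -/
noncomputable def charRoot (w : ℝ) (k : Fin 3) : ℂ := Complex.I * w * cubeRoot ^ (k : ℕ)

theorem charRoot_pow_six (w : ℝ) (k : Fin 3) : charRoot w k ^ 6 = -(w : ℂ) ^ 6 := by
  have h1 : (cubeRoot ^ (k : ℕ)) ^ 6 = 1 := by
    rw [← pow_mul, mul_comm, show 6 = 3 * 2 from rfl, mul_assoc, pow_mul, cubeRoot_pow_three,
      one_pow]
  have h2 : Complex.I ^ 6 = -1 := by
    rw [show 6 = 2 * 3 from rfl, pow_mul, Complex.I_sq]; norm_num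
  rw [charRoot, mul_pow, mul_pow, h1, h2]
  ring

theorem charRoot_ne_zero {w : ℝ} (hw : w ≠ 0) (k : Fin 3) : charRoot w k ≠ 0 := by
  unfold charRoot
  exact mul_ne_zero (mul_ne_zero Complex.I_ne_zero (by exact_mod_cast hw))
    (pow_ne_zero _ cubeRoot_ne_zero)

/-- `e ^ (r_k / 2) + ε e ^ (- r_k / 2)` for the characteristic root `r_k`. -/
noncomputable def hyp (w : ℝ) (ε : ℂ) (k : Fin 3) : ℂ :=
  Complex.exp (charRoot w k / 2) + ε * Complex.exp (-(charRoot w k / 2))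

/-- The matrix of the boundary value problem restricted to functions which are symmetric
(`ε = 1`) or antisymmetric (`ε = -1`) about the midpoint. -/
noncomputable def charMatrix (w : ℝ) (ε : ℂ) : Matrix (Fin 3) (Fin 3) ℂ :=
  Matrix.of fun k => ![charRoot w k ^ 2 * hyp w ε k, charRoot w k * hyp w (-ε) k, hyp w ε k]

/-- The endpoint data `(u''', u'''', u⁽⁵⁾)` at `0` and `1`, split by symmetry. -/
noncomputable def endData (u : ℝ → ℂ) (ε : ℂ) : Fin 3 → ℂ :=
  ![iteratedDerivWithin 3 u (Icc 0 1) 0 - ε * iteratedDerivWithin 3 u (Icc 0 1) 1,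
    iteratedDerivWithin 4 u (Icc 0 1) 0 + ε * iteratedDerivWithin 4 u (Icc 0 1) 1,
    iteratedDerivWithin 5 u (Icc 0 1) 0 - ε * iteratedDerivWithin 5 u (Icc 0 1) 1]

/-! ### From solutions to kernel vectors -/

section Forward

variable {w : ℝ} {u : ℝ → ℂ}

/-- For a characteristic root `r`, the function `Σ r ^ (5 - m) u⁽ᵐ⁾` is a multiple of `e ^ (r x)`. -/
theorem IsSolution.sum_eq {z : ℂ} (hu : IsSolution 3 z u) {r : ℂ} (hr : r ^ 6 = -z) {x : ℝ}
    (hx : x ∈ Icc (0 : ℝ) 1) :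
    ∑ m ∈ Finset.range 6, r ^ (5 - m) * iteratedDerivWithin m u (Icc 0 1) x =
      Complex.exp (r * x) *
        ∑ m ∈ Finset.range 6, r ^ (5 - m) * iteratedDerivWithin m u (Icc 0 1) 0 := by
  set U : ℕ → ℝ → ℂ := fun m => iteratedDerivWithin m u (Icc 0 1) with hU
  have h6 : ∀ x ∈ Icc (0 : ℝ) 1, U 6 x = -(z * U 0 x) := by
    intro x hx
    have := hu.ode x hx
    simp only [hU, iteratedDerivWithin_zero]
    rw [← this]
    norm_num
  -- The sum is `((D⁶ - r⁶) / (D - r)) u`, so it is annihilated by `D - r`.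
  have key := eq_left_of_hasDerivWithinAt_zero
    (f := fun y => (∑ m ∈ Finset.range 6, r ^ (5 - m) * U m y) * Complex.exp (-(r * y)))
    (fun y hy => ?_) hx
  · simp only [Complex.ofReal_zero, mul_zero, neg_zero, Complex.exp_zero, mul_one] at key
    rw [← key, mul_comm, mul_assoc, ← Complex.exp_add]
    simp [hU]
  · have h1 : HasDerivWithinAt (fun y => ∑ m ∈ Finset.range 6, r ^ (5 - m) * U m y)
        (∑ m ∈ Finset.range 6, r ^ (5 - m) * U (m + 1) y) (Icc 0 1) y :=
      HasDerivWithinAt.fun_sum fun m hm =>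
        (hu.hasDerivWithinAt (by simpa using hm) hy).const_mul _
    have h2 : HasDerivAt (fun y : ℝ => Complex.exp (-(r * y))) (Complex.exp (-(r * y)) * (-r)) y := by
      have : HasDerivAt (fun y : ℂ => Complex.exp (-(r * y))) (Complex.exp (-(r * y)) * (-r))
          (y : ℂ) := by
        simpa using (((hasDerivAt_id (y : ℂ)).const_mul r).neg).cexp
      exact this.comp_ofReal
    refine (h1.mul h2.hasDerivWithinAt).congr_deriv ?_
    simp only [Finset.sum_range_succ, Finset.sum_range_zero, h6 y hy, Nat.reduceAdd, Nat.reduceSub]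
    linear_combination -(Complex.exp (-(r * y)) * U 0 y) * hr

theorem IsSolution.boundary_eq {z : ℂ} (hu : IsSolution 3 z u) {r : ℂ} (hr : r ^ 6 = -z) :
    (r ^ 2 * iteratedDerivWithin 3 u (Icc 0 1) 1 + r * iteratedDerivWithin 4 u (Icc 0 1) 1 +
      iteratedDerivWithin 5 u (Icc 0 1) 1) * Complex.exp (-(r / 2)) =
    (r ^ 2 * iteratedDerivWithin 3 u (Icc 0 1) 0 + r * iteratedDerivWithin 4 u (Icc 0 1) 0 +
      iteratedDerivWithin 5 u (Icc 0 1) 0) * Complex.exp (r / 2) := by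
  have h := hu.sum_eq hr (right_mem_Icc.2 zero_le_one)
  simp only [Finset.sum_range_succ, Finset.sum_range_zero, hu.left 0 (by norm_num),
    hu.left 1 (by norm_num), hu.left 2 (by norm_num), hu.right 0 (by norm_num),
    hu.right 1 (by norm_num), hu.right 2 (by norm_num), Nat.reduceSub] at h
  have e : Complex.exp (r * (1 : ℝ)) * Complex.exp (-(r / 2)) = Complex.exp (r / 2) := by
    rw [← Complex.exp_add]
    congr 1
    push_cast
    ring
  rw [← e]
  linear_combination Complex.exp (-(r / 2)) * h

/-- Adding `ε` times the boundary relation for `-r` to the one for `r` combines the data at 0 and 1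
into the part of one symmetry type. -/
theorem IsSolution.charMatrix_mulVec (hu : IsSolution 3 ((w : ℂ) ^ 6) u) {ε : ℂ} (hε : ε ^ 2 = 1) :
    (charMatrix w ε).mulVec (endData u ε) = 0 := by
  ext k
  have h1 := hu.boundary_eq (charRoot_pow_six w k)
  have h2 := hu.boundary_eq (r := -charRoot w k)
    (by rw [Even.neg_pow (by decide), charRoot_pow_six w k])
  rw [neg_div, neg_neg] at h2
  simp only [charMatrix, endData, hyp, Matrix.mulVec, dotProduct, Fin.sum_univ_three,
    Matrix.of_apply, Matrix.cons_val, Pi.zero_apply]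
  set E := Complex.exp (charRoot w k / 2)
  set F := Complex.exp (-(charRoot w k / 2))
  set r := charRoot w k
  set U : ℕ → ℝ → ℂ := fun m => iteratedDerivWithin m u (Icc 0 1)
  change r ^ 2 * (E + ε * F) * (U 3 0 - ε * U 3 1) + r * (E + -ε * F) * (U 4 0 + ε * U 4 1) +
    (E + ε * F) * (U 5 0 - ε * U 5 1) = 0
  change (r ^ 2 * U 3 1 + r * U 4 1 + U 5 1) * F = (r ^ 2 * U 3 0 + r * U 4 0 + U 5 0) * E at h1
  change ((-r) ^ 2 * U 3 1 + (-r) * U 4 1 + U 5 1) * E =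
    ((-r) ^ 2 * U 3 0 + (-r) * U 4 0 + U 5 0) * F at h2
  linear_combination -h1 - ε * h2 - F * (r ^ 2 * U 3 1 + r * U 4 1 + U 5 1) * hε

/-- A solution is determined by its endpoint data. -/
theorem IsSolution.eq_zero_of_endData (hw : w ≠ 0) (hu : IsSolution 3 ((w : ℂ) ^ 6) u)
    (h1 : endData u 1 = 0) (h2 : endData u (-1) = 0) {x : ℝ} (hx : x ∈ Icc (0 : ℝ) 1) :
    u x = 0 := by
  set U : ℕ → ℝ → ℂ := fun m => iteratedDerivWithin m u (Icc 0 1) with hU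
  have e3 : U 3 0 = 0 := by
    have a := congrFun h1 0
    have b := congrFun h2 0
    simp only [endData, Matrix.cons_val, Pi.zero_apply] at a b
    linear_combination (a + b) / 2
  have e4 : U 4 0 = 0 := by
    have a := congrFun h1 1
    have b := congrFun h2 1
    simp only [endData, Matrix.cons_val, Pi.zero_apply] at a b
    linear_combination (a + b) / 2
  have e5 : U 5 0 = 0 := by
    have a := congrFun h1 2
    have b := congrFun h2 2
    simp only [endData, Matrix.cons_val, Pi.zero_apply] at a b
    linear_combination (a + b) / 2
  have hl : ∀ k < 3, U k 0 = 0 := hu.left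
  have hsum : ∀ r : ℂ, r ^ 6 = -(w : ℂ) ^ 6 →
      r ^ 5 * U 0 x + r ^ 4 * U 1 x + r ^ 3 * U 2 x + r ^ 2 * U 3 x + r * U 4 x + U 5 x = 0 := by
    intro r hr
    have h := hu.sum_eq hr hx
    change ∑ m ∈ Finset.range 6, r ^ (5 - m) * U m x =
      Complex.exp (r * x) * ∑ m ∈ Finset.range 6, r ^ (5 - m) * U m 0 at h
    simp only [Finset.sum_range_succ, Finset.sum_range_zero, hl 0 (by norm_num),
      hl 1 (by norm_num), hl 2 (by norm_num), e3, e4, e5, Nat.reduceSub] at h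
    linear_combination h
  -- The part of `hsum` odd in `r`, divided by `r`, involves only `u`, `u''`, `u''''`. Weighting the
  -- three relations by `1, ρ², ρ` then isolates `u`.
  have hodd : ∀ k, charRoot w k ^ 4 * U 0 x + charRoot w k ^ 2 * U 2 x + U 4 x = 0 := by
    intro k
    have a := hsum _ (charRoot_pow_six w k)
    have b := hsum (-charRoot w k) (by rw [Even.neg_pow (by decide), charRoot_pow_six w k])
    refine (mul_eq_zero.1 ?_).resolve_left (charRoot_ne_zero hw k)
    linear_combination (a - b) / 2
  have a0 := hodd 0
  have a1 := hodd 1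
  have a2 := hodd 2
  have hU0 : U 0 x = u x := by simp [hU]
  rw [hU0] at a0 a1 a2
  have hc := cubeRoot_sq_add
  have h0 := charRoot_ne_zero hw 0
  simp only [charRoot, Fin.val_zero, Fin.val_one, Fin.val_two, pow_zero, pow_one, mul_one]
    at a0 a1 a2 h0
  set s := Complex.I * (w : ℂ)
  have hc4 : cubeRoot ^ 4 = cubeRoot := by linear_combination cubeRoot * cubeRoot_pow_three
  have hc2 : cubeRoot ^ 2 = -1 - cubeRoot := by linear_combination hc
  have hc8 : (cubeRoot ^ 2) ^ 4 = -1 - cubeRoot := by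
    linear_combination hc2 + (cubeRoot ^ 5 + cubeRoot ^ 2) * cubeRoot_pow_three
  have hc24 : (cubeRoot ^ 2) ^ 2 = cubeRoot := by linear_combination hc4
  rw [mul_pow s, mul_pow s, hc4, hc2] at a1
  rw [mul_pow s, mul_pow s, hc8, hc24] at a2
  have : 3 * s ^ 4 * u x = 0 := by
    linear_combination a0 + (-1 - cubeRoot) * a1 + cubeRoot * a2 +
      (2 * s ^ 4 * u x - 2 * s ^ 2 * U 2 x) * hc
  have h4 : s ^ 4 ≠ 0 := pow_ne_zero _ h0
  simpa [h4] using this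

end Forward

/-! ### Evaluation of the two determinants -/

section Determinant

theorem sum_charRoot (w : ℝ) : charRoot w 0 + charRoot w 1 + charRoot w 2 = 0 := by
  simp only [charRoot, Fin.val_zero, Fin.val_one, Fin.val_two]
  linear_combination Complex.I * w * cubeRoot_sq_add

theorem prod_exp_charRoot (w : ℝ) :
    Complex.exp (charRoot w 0 / 2) * Complex.exp (charRoot w 1 / 2) *
      Complex.exp (charRoot w 2 / 2) = 1 := by
  rw [← Complex.exp_add, ← Complex.exp_add, Complex.exp_eq_one_iff]
  exact ⟨0, by linear_combination sum_charRoot w / 2⟩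

theorem prod_exp_neg_charRoot (w : ℝ) :
    Complex.exp (-(charRoot w 0 / 2)) * Complex.exp (-(charRoot w 1 / 2)) *
      Complex.exp (-(charRoot w 2 / 2)) = 1 := by
  rw [← Complex.exp_add, ← Complex.exp_add, Complex.exp_eq_one_iff]
  exact ⟨0, by linear_combination -sum_charRoot w / 2⟩

theorem det_charMatrix (w : ℝ) (ε : ℂ) :
    (charMatrix w ε).det = (Complex.I * w) ^ 3 * (cubeRoot - cubeRoot ^ 2) *
      (hyp w (-ε) 0 * hyp w ε 1 * hyp w ε 2 + hyp w ε 0 * hyp w (-ε) 1 * hyp w ε 2 +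
        hyp w ε 0 * hyp w ε 1 * hyp w (-ε) 2) := by
  rw [Matrix.det_fin_three]
  simp only [charMatrix, Matrix.of_apply, Matrix.cons_val]
  simp only [charRoot, Fin.val_zero, Fin.val_one, Fin.val_two, pow_zero, pow_one, mul_one]
  linear_combination ((Complex.I * w) ^ 3 * (hyp w (-ε) 0 * hyp w ε 1 * hyp w ε 2 * cubeRoot
    - hyp w ε 0 * hyp w (-ε) 1 * hyp w ε 2 * cubeRoot ^ 2
    + hyp w ε 0 * hyp w ε 1 * hyp w (-ε) 2 * cubeRoot)) * cubeRoot_pow_three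

theorem charFactor_ne_zero {w : ℝ} (hw : w ≠ 0) :
    (Complex.I * w) ^ 3 * (cubeRoot - cubeRoot ^ 2) ≠ 0 := by
  refine mul_ne_zero (pow_ne_zero _ (mul_ne_zero Complex.I_ne_zero (by exact_mod_cast hw))) ?_
  rw [show cubeRoot - cubeRoot ^ 2 = cubeRoot * (1 - cubeRoot) by ring]
  exact mul_ne_zero cubeRoot_ne_zero (sub_ne_zero.2 cubeRoot_ne_one.symm)

/-- This is the addition formula for `sinh (a + b + c)` with `a + b + c = 0`; the companion for `ε =
-1` is the one for cosh, where `8 cosh 0` produces the 8. -/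
theorem det_charMatrix_one (w : ℝ) :
    (charMatrix w 1).det = -((Complex.I * w) ^ 3 * (cubeRoot - cubeRoot ^ 2) *
      (hyp w (-1) 0 * hyp w (-1) 1 * hyp w (-1) 2)) := by
  rw [det_charMatrix]
  unfold hyp
  linear_combination (4 * (Complex.I * w) ^ 3 * (cubeRoot - cubeRoot ^ 2)) *
    (prod_exp_charRoot w - prod_exp_neg_charRoot w)

theorem det_charMatrix_neg_one (w : ℝ) :
    (charMatrix w (-1)).det = (Complex.I * w) ^ 3 * (cubeRoot - cubeRoot ^ 2) *
      (8 - hyp w 1 0 * hyp w 1 1 * hyp w 1 2) := by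
  rw [det_charMatrix, neg_neg]
  unfold hyp
  linear_combination (4 * (Complex.I * w) ^ 3 * (cubeRoot - cubeRoot ^ 2)) *
    (prod_exp_charRoot w + prod_exp_neg_charRoot w)

theorem charRoot_zero_div_two (w : ℝ) : charRoot w 0 / 2 = (w / 2 : ℝ) * Complex.I := by
  simp only [charRoot, Fin.val_zero, pow_zero]
  push_cast
  ring

theorem hyp_neg_one_zero (w : ℝ) : hyp w (-1) 0 = 2 * Complex.I * Real.sin (w / 2) := by
  rw [hyp, charRoot_zero_div_two, ← neg_mul, ← Complex.ofReal_neg, Complex.exp_ofReal_mul_I,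
    Complex.exp_ofReal_mul_I, Real.cos_neg, Real.sin_neg]
  push_cast
  ring

theorem hyp_one_zero (w : ℝ) : hyp w 1 0 = 2 * Real.cos (w / 2) := by
  rw [hyp, charRoot_zero_div_two, ← neg_mul, ← Complex.ofReal_neg, Complex.exp_ofReal_mul_I,
    Complex.exp_ofReal_mul_I, Real.cos_neg, Real.sin_neg]
  push_cast
  ring

theorem charRoot_one_re (w : ℝ) : (charRoot w 1).re = -(√3 / 2 * w) := by
  simp [charRoot, cubeRoot]
  ring

theorem charRoot_two_re (w : ℝ) : (charRoot w 2).re = √3 / 2 * w := by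
  have h := congrArg Complex.re (sum_charRoot w)
  have h0 : (charRoot w 0).re = 0 := by simp [charRoot]
  simp only [Complex.add_re, h0, charRoot_one_re, Complex.zero_re] at h
  linarith

/-- Equality of `e ^ (r / 2)` and `e ^ (-r / 2)` forces equal moduli, hence `re r = 0`. Of the three
roots, only the one with `k = 0` is imaginary for `w ≠ 0`. -/
theorem hyp_neg_one_ne_zero {w : ℝ} {k : Fin 3} (hk : (charRoot w k).re ≠ 0) :
    hyp w (-1) k ≠ 0 := by
  intro h
  have h1 : Complex.exp (charRoot w k / 2) = Complex.exp (-(charRoot w k / 2)) := by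
    unfold hyp at h
    linear_combination h
  have h2 := congrArg norm h1
  rw [Complex.norm_exp, Complex.norm_exp, Real.exp_eq_exp] at h2
  apply hk
  have h3 : (charRoot w k / 2).re = (charRoot w k).re / 2 := by simp
  rw [Complex.neg_re, h3] at h2
  linarith

theorem hyp_neg_one_one_ne_zero {w : ℝ} (hw : w ≠ 0) : hyp w (-1) 1 ≠ 0 :=
  hyp_neg_one_ne_zero (by rw [charRoot_one_re]; simpa using hw)

theorem hyp_neg_one_two_ne_zero {w : ℝ} (hw : w ≠ 0) : hyp w (-1) 2 ≠ 0 :=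
  hyp_neg_one_ne_zero (by rw [charRoot_two_re]; simpa using hw)

/-- Product-to-sum for cosh: `r_1 + r_2 = -r_0` is imaginary and gives the cosine, while `r_1 - r_2
= -√3 w` is real and gives the cosh. -/
theorem hyp_one_mul_hyp_one (w : ℝ) :
    hyp w 1 1 * hyp w 1 2 = 2 * (Real.cos (w / 2) + Real.cosh (√3 * (w / 2))) := by
  have h0 := hyp_one_zero w
  have e1 : Complex.exp (charRoot w 1 / 2) * Complex.exp (charRoot w 2 / 2) =
      Complex.exp (-(charRoot w 0 / 2)) := by
    rw [← Complex.exp_add]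
    congr 1
    linear_combination sum_charRoot w / 2
  have e2 : Complex.exp (-(charRoot w 1 / 2)) * Complex.exp (-(charRoot w 2 / 2)) =
      Complex.exp (charRoot w 0 / 2) := by
    rw [← Complex.exp_add]
    congr 1
    linear_combination -sum_charRoot w / 2
  have hd : charRoot w 1 / 2 - charRoot w 2 / 2 = ((-(√3 * (w / 2)) : ℝ) : ℂ) := by
    simp only [charRoot, Fin.val_one, Fin.val_two, pow_one]
    have : cubeRoot ^ 2 = -1 - cubeRoot := by linear_combination cubeRoot_sq_add
    rw [this, cubeRoot]
    push_cast
    linear_combination ((√3 : ℝ) * w / 2 : ℂ) * Complex.I_sq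
  have e3 : Complex.exp (charRoot w 1 / 2) * Complex.exp (-(charRoot w 2 / 2)) =
      (Real.exp (-(√3 * (w / 2))) : ℂ) := by
    rw [← Complex.exp_add, ← sub_eq_add_neg, hd, Complex.ofReal_exp]
  have e4 : Complex.exp (-(charRoot w 1 / 2)) * Complex.exp (charRoot w 2 / 2) =
      (Real.exp (√3 * (w / 2)) : ℂ) := by
    rw [← Complex.exp_add, show -(charRoot w 1 / 2) + charRoot w 2 / 2 =
      -(charRoot w 1 / 2 - charRoot w 2 / 2) by ring, hd, ← Complex.ofReal_neg, neg_neg,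
      Complex.ofReal_exp]
  rw [Real.cosh_eq]
  push_cast at e3 e4 ⊢
  unfold hyp at h0 ⊢
  push_cast at h0
  linear_combination e1 + e2 + e3 + e4 + h0

theorem det_charMatrix_one_eq_zero_iff {w : ℝ} (hw : w ≠ 0) :
    (charMatrix w 1).det = 0 ↔ Real.sin (w / 2) = 0 := by
  rw [det_charMatrix_one, neg_eq_zero, mul_eq_zero, or_iff_right (charFactor_ne_zero hw),
    mul_eq_zero, or_iff_left (hyp_neg_one_two_ne_zero hw), mul_eq_zero,
    or_iff_left (hyp_neg_one_one_ne_zero hw), hyp_neg_one_zero, mul_eq_zero,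
    or_iff_right (by simp), Complex.ofReal_eq_zero]

theorem det_charMatrix_neg_one_eq_zero_iff {w : ℝ} (hw : w ≠ 0) :
    (charMatrix w (-1)).det = 0 ↔
      Real.cos (w / 2) * (Real.cos (w / 2) + Real.cosh (√3 * (w / 2))) = 2 := by
  rw [det_charMatrix_neg_one, mul_eq_zero, or_iff_right (charFactor_ne_zero hw), mul_assoc,
    hyp_one_mul_hyp_one, hyp_one_zero]
  have : (8 - 2 * (Real.cos (w / 2) : ℂ) *
      (2 * ((Real.cos (w / 2) : ℂ) + (Real.cosh (√3 * (w / 2)) : ℂ)))) =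
      ((8 - 4 * (Real.cos (w / 2) * (Real.cos (w / 2) + Real.cosh (√3 * (w / 2)))) : ℝ) : ℂ) := by
    push_cast
    ring
  rw [this, Complex.ofReal_eq_zero]
  constructor <;> intro h <;> linarith

/-- If `sin θ = 0` then `cos θ = ± 1`, and the odd expression is `1 + cosh > 2` or `1 - cosh < 0`.
-/
theorem det_charMatrix_neg_one_ne_zero {w : ℝ} (hw : w ≠ 0) (h : (charMatrix w 1).det = 0) :
    (charMatrix w (-1)).det ≠ 0 := by
  rw [det_charMatrix_one_eq_zero_iff hw] at h
  rw [Ne, det_charMatrix_neg_one_eq_zero_iff hw]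
  have hch : 1 < Real.cosh (√3 * (w / 2)) := Real.one_lt_cosh.2 (by positivity)
  rcases Real.sin_eq_zero_iff_cos_eq.1 h with h | h <;> rw [h] <;> intro h' <;> linarith

end Determinant

/-! ### From kernel vectors to solutions -/

section Backward

variable {w : ℝ} {ε : ℂ}

/-- The formal `m`-th derivative of the combination `Σ A_k (e ^ (r_k t) + ε e ^ (-r_k t))`
with `t = x - 1 / 2`. -/
noncomputable def expSum (w : ℝ) (ε : ℂ) (A : Fin 3 → ℂ) (m : ℕ) (x : ℝ) : ℂ :=
  ∑ k, A k * charRoot w k ^ m * (Complex.exp (charRoot w k * (x - 1 / 2)) +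
    ε * (-1) ^ m * Complex.exp (-(charRoot w k * (x - 1 / 2))))

theorem hasDerivAt_expSum (w : ℝ) (ε : ℂ) (A : Fin 3 → ℂ) (m : ℕ) (x : ℝ) :
    HasDerivAt (expSum w ε A m) (expSum w ε A (m + 1) x) x := by
  unfold expSum
  refine HasDerivAt.fun_sum fun k _ => ?_
  have h1 : HasDerivAt (fun y : ℂ => charRoot w k * (y - 1 / 2)) (charRoot w k) (x : ℂ) :=
    (((hasDerivAt_id (x : ℂ)).sub_const (1 / 2)).const_mul (charRoot w k)).congr_deriv (mul_one _)
  have := ((h1.cexp.add (h1.neg.cexp.const_mul (ε * (-1) ^ m))).const_mul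
    (A k * charRoot w k ^ m)).comp_ofReal
  refine this.congr_deriv ?_
  simp only [Pi.neg_apply]
  ring

theorem iteratedDerivWithin_expSum (w : ℝ) (ε : ℂ) (A : Fin 3 → ℂ) (m : ℕ) :
    EqOn (iteratedDerivWithin m (expSum w ε A 0) (Icc 0 1)) (expSum w ε A m) (Icc 0 1) := by
  induction m with
  | zero => intro x _; simp
  | succ m ih =>
    intro x hx
    rw [iteratedDerivWithin_succ, derivWithin_congr ih (ih hx)]
    exact (hasDerivAt_expSum w ε A m x).hasDerivWithinAt.derivWithin
      (uniqueDiffOn_Icc zero_lt_one x hx)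

theorem expSum_zero_eq (hε : ε ^ 2 = 1) (A : Fin 3 → ℂ) (m : ℕ) :
    expSum w ε A m 0 = ε * (-1) ^ m * expSum w ε A m 1 := by
  have h1 : ((-1 : ℂ) ^ m) ^ 2 = 1 := by rw [← pow_mul, mul_comm, pow_mul]; norm_num
  unfold expSum
  rw [Finset.mul_sum]
  refine Finset.sum_congr rfl fun k _ => ?_
  push_cast
  rw [show charRoot w k * ((0 : ℂ) - 1 / 2) = -(charRoot w k * (1 - 1 / 2)) by ring, neg_neg]
  linear_combination -(A k * charRoot w k ^ m * Complex.exp (-(charRoot w k * (1 - 1 / 2)))) *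
    (h1 * ε ^ 2 + hε)

/-- The columns of the block list `u''`, `u'`, `u` at 1 for each exponential pair, so a left kernel
vector meets the conditions there; symmetry transfers them to 0. -/
theorem isSolution_expSum (hε : ε ^ 2 = 1) {A : Fin 3 → ℂ}
    (hA : Matrix.vecMul A (charMatrix w ε) = 0) :
    IsSolution 3 ((w : ℂ) ^ 6) (expSum w ε A 0) := by
  have hr : ∀ m < 3, expSum w ε A m 1 = 0 := by
    intro m hm
    have e : ∀ k, charRoot w k * (((1 : ℝ) : ℂ) - 1 / 2) = charRoot w k / 2 := fun k => by
      push_cast; ring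
    have h0 := congrFun hA 0
    have h1 := congrFun hA 1
    have h2 := congrFun hA 2
    simp only [Matrix.vecMul, dotProduct, charMatrix, Fin.sum_univ_three, Matrix.of_apply,
      Matrix.cons_val, Pi.zero_apply, hyp] at h0 h1 h2
    simp only [expSum, Fin.sum_univ_three, e]
    interval_cases m
    · linear_combination h2
    · linear_combination h1
    · linear_combination h0
  refine ⟨?_, fun x hx => ?_, fun k hk => ?_, fun k hk => ?_⟩
  · have : ContDiff ℝ ((2 * 3 : ℕ) : WithTop ℕ∞) (expSum w ε A 0) := by
      have hof : ContDiff ℝ ((2 * 3 : ℕ) : WithTop ℕ∞) (fun x : ℝ => (x : ℂ)) :=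
        Complex.ofRealCLM.contDiff
      unfold expSum
      fun_prop
    exact this.contDiffOn
  · rw [iteratedDerivWithin_expSum w ε A _ hx]
    unfold expSum
    rw [Finset.mul_sum, Finset.mul_sum]
    refine Finset.sum_congr rfl fun k _ => ?_
    rw [show 2 * 3 = 6 from rfl, charRoot_pow_six]
    ring
  · rw [iteratedDerivWithin_expSum w ε A _ (left_mem_Icc.2 zero_le_one), expSum_zero_eq hε,
      hr k hk, mul_zero]
  · rw [iteratedDerivWithin_expSum w ε A _ (right_mem_Icc.2 zero_le_one), hr k hk]

/-- Fourier inversion on `ℤ / 3`. -/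
theorem eq_zero_of_sum_cubeRoot {A : Fin 3 → ℂ} (h0 : A 0 + A 1 + A 2 = 0)
    (h1 : A 0 + A 1 * cubeRoot + A 2 * cubeRoot ^ 2 = 0)
    (h2 : A 0 + A 1 * cubeRoot ^ 2 + A 2 * cubeRoot = 0) : A = 0 := by
  have hc := cubeRoot_sq_add
  ext k
  fin_cases k <;> simp only [Fin.zero_eta, Fin.mk_one, Fin.reduceFinMk, Pi.zero_apply]
  · linear_combination (h0 + h1 + h2 - (A 1 + A 2) * hc) / 3
  · linear_combination (h0 + cubeRoot ^ 2 * h1 + cubeRoot * h2 - (A 0 + A 2) * hc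
      - (2 * A 1 + A 2 * cubeRoot - A 2) * cubeRoot_pow_three + A 2 * (1 - cubeRoot) * hc) / 3
  · linear_combination (h0 + cubeRoot * h1 + cubeRoot ^ 2 * h2 - (A 0 + A 1) * hc
      - (2 * A 2 + A 1 * cubeRoot - A 1) * cubeRoot_pow_three + A 1 * (1 - cubeRoot) * hc) / 3

theorem exists_expSum_ne_zero (hw : w ≠ 0) (hε : ε = 1 ∨ ε = -1) {A : Fin 3 → ℂ} (hA : A ≠ 0) :
    ∃ x ∈ Icc (0 : ℝ) 1, expSum w ε A 0 x ≠ 0 := by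
  by_contra! h
  have hmid : (1 / 2 : ℝ) ∈ Icc (0 : ℝ) 1 := by constructor <;> norm_num
  have hz : ∀ m, expSum w ε A m (1 / 2) = 0 := by
    intro m
    rw [← iteratedDerivWithin_expSum w ε A m hmid,
      iteratedDerivWithin_congr (g := fun _ => (0 : ℂ)) h hmid]
    simp
  have hI : Complex.I * (w : ℂ) ≠ 0 := mul_ne_zero Complex.I_ne_zero (by exact_mod_cast hw)
  -- Only derivatives of the parity of the symmetry type survive at the midpoint. The orders `0, 2,
  -- 4` and `3, 1, 5` each cover all residues mod 3.
  have hs : ∀ m, ε * (-1) ^ m = 1 → ∑ k : Fin 3, A k * (cubeRoot ^ (k : ℕ)) ^ m = 0 := by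
    intro m hm
    have h := hz m
    simp only [expSum, hm, charRoot] at h
    norm_num at h
    refine (mul_eq_zero.1 ?_).resolve_left
      (mul_ne_zero (pow_ne_zero m hI) (two_ne_zero (α := ℂ)))
    rw [← h, Finset.mul_sum]
    exact Finset.sum_congr rfl fun k _ => by ring
  have h3 := cubeRoot_pow_three
  apply hA
  rcases hε with rfl | rfl
  · have h0 := hs 0 (by norm_num)
    have h1 := hs 2 (by norm_num)
    have h2 := hs 4 (by norm_num)
    simp only [Fin.sum_univ_three, Fin.val_zero, Fin.val_one, Fin.val_two] at h0 h1 h2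
    refine eq_zero_of_sum_cubeRoot ?_ ?_ ?_
    · linear_combination h0
    · linear_combination h2 - (A 1 * cubeRoot + A 2 * (cubeRoot ^ 5 + cubeRoot ^ 2)) * h3
    · linear_combination h1 - A 2 * cubeRoot * h3
  · have h0 := hs 3 (by norm_num)
    have h1 := hs 1 (by norm_num)
    have h2 := hs 5 (by norm_num)
    simp only [Fin.sum_univ_three, Fin.val_zero, Fin.val_one, Fin.val_two] at h0 h1 h2
    refine eq_zero_of_sum_cubeRoot ?_ ?_ ?_
    · linear_combination h0 - (A 1 + A 2 * (cubeRoot ^ 3 + 1)) * h3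
    · linear_combination h1
    · linear_combination h2 - (A 1 * cubeRoot ^ 2 +
        A 2 * (cubeRoot ^ 7 + cubeRoot ^ 4 + cubeRoot)) * h3

theorem exists_isSolution_of_det_eq_zero (hw : w ≠ 0) (hε : ε = 1 ∨ ε = -1)
    (hdet : (charMatrix w ε).det = 0) :
    ∃ u, IsSolution 3 ((w : ℂ) ^ 6) u ∧ ∃ x ∈ Icc (0 : ℝ) 1, u x ≠ 0 := by
  obtain ⟨A, hA, h⟩ := Matrix.exists_vecMul_eq_zero_iff.2 hdet
  exact ⟨_, isSolution_expSum (by rcases hε with rfl | rfl <;> norm_num) h,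
    exists_expSum_ne_zero hw hε hA⟩

end Backward

/-! ### Multiplicities -/

section Rank

variable {w : ℝ}

theorem iteratedDerivWithin_add_smul {z : ℂ} {u v : ℝ → ℂ} (hu : IsSolution 3 z u)
    (hv : IsSolution 3 z v) (c : ℂ) {k : ℕ} (hk : k ≤ 6) {x : ℝ} (hx : x ∈ Icc (0 : ℝ) 1) :
    iteratedDerivWithin k (u + c • v) (Icc 0 1) x =
      iteratedDerivWithin k u (Icc 0 1) x + c * iteratedDerivWithin k v (Icc 0 1) x := by
  have hk' : ((k : ℕ) : WithTop ℕ∞) ≤ ((2 * 3 : ℕ) : WithTop ℕ∞) := by exact_mod_cast hk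
  rw [iteratedDerivWithin_add hx (uniqueDiffOn_Icc zero_lt_one)
    ((hu.contDiffOn x hx).of_le hk') (((hv.smul c).contDiffOn x hx).of_le hk'),
    iteratedDerivWithin_const_smul_field, smul_eq_mul]

theorem endData_add_smul {z : ℂ} {u v : ℝ → ℂ} (hu : IsSolution 3 z u) (hv : IsSolution 3 z v)
    (c ε : ℂ) : endData (u + c • v) ε = endData u ε + c • endData v ε := by
  have h0 : (0 : ℝ) ∈ Icc (0 : ℝ) 1 := left_mem_Icc.2 zero_le_one
  have h1 : (1 : ℝ) ∈ Icc (0 : ℝ) 1 := right_mem_Icc.2 zero_le_one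
  unfold endData
  ext i
  fin_cases i <;> simp [iteratedDerivWithin_add_smul hu hv, h0, h1] <;> ring

theorem rank_eigenspace_eq_zero {α : ℕ} {z : ℂ}
    (h : ∀ u, IsSolution α z u → ∀ x ∈ Icc (0 : ℝ) 1, u x = 0) :
    Module.rank ℂ (eigenspace α z) = 0 := by
  have : eigenspace α z = ⊥ := by
    rw [eq_bot_iff]
    rintro v ⟨u, hu, huv⟩
    rw [Submodule.mem_bot]
    ext x
    rw [huv x, h u hu x x.2]
    rfl
  rw [this, rank_bot]

/-- One linear functional that is injective on solutions bounds the dimension by 1. -/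
theorem rank_eigenspace_eq_one {z : ℂ} {ε : ℂ} {i : Fin 3}
    (hex : ∃ u, IsSolution 3 z u ∧ ∃ x ∈ Icc (0 : ℝ) 1, u x ≠ 0)
    (hinj : ∀ u, IsSolution 3 z u → endData u ε i = 0 → ∀ x ∈ Icc (0 : ℝ) 1, u x = 0) :
    Module.rank ℂ (eigenspace 3 z) = 1 := by
  obtain ⟨u₀, hu₀, x₀, hx₀, hne⟩ := hex
  let v₀ : eigenspace 3 z := ⟨fun x => u₀ x, u₀, hu₀, fun _ => rfl⟩
  apply le_antisymm
  · rw [rank_le_one_iff]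
    refine ⟨v₀, ?_⟩
    rintro ⟨v, u, hu, huv⟩
    have hφ : endData u₀ ε i ≠ 0 := fun h => hne (hinj u₀ hu₀ h x₀ hx₀)
    set c := endData u ε i / endData u₀ ε i with hc
    have hz := hinj (u + (-c) • u₀) (hu.add (hu₀.smul _)) (by
      rw [endData_add_smul hu hu₀]
      simp [hc, hφ])
    refine ⟨c, Subtype.ext (funext fun x => ?_)⟩
    have := hz x x.2
    simp only [Pi.add_apply, Pi.smul_apply, smul_eq_mul] at this
    change c * u₀ x = v x
    rw [huv x]
    linear_combination -this
  · rw [Cardinal.one_le_iff_pos, rank_pos_iff_nontrivial]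
    refine ⟨v₀, 0, fun h => hne ?_⟩
    exact congrFun (congrArg Subtype.val h) ⟨x₀, hx₀⟩

theorem IsSolution.endData_eq_zero {u : ℝ → ℂ} (hu : IsSolution 3 ((w : ℂ) ^ 6) u) {ε : ℂ}
    (hε : ε ^ 2 = 1) (hdet : (charMatrix w ε).det ≠ 0) : endData u ε = 0 :=
  Matrix.eq_zero_of_mulVec_eq_zero hdet (hu.charMatrix_mulVec hε)

theorem rank_eigenspace_of_det_ne_zero (hw : w ≠ 0) (h1 : (charMatrix w 1).det ≠ 0)
    (h2 : (charMatrix w (-1)).det ≠ 0) : Module.rank ℂ (eigenspace 3 ((w : ℂ) ^ 6)) = 0 :=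
  rank_eigenspace_eq_zero fun _ hu _ hx => hu.eq_zero_of_endData hw
    (hu.endData_eq_zero (by norm_num) h1) (hu.endData_eq_zero (by norm_num) h2) hx

theorem rank_eigenspace_of_det_one (hw : w ≠ 0) (h1 : (charMatrix w 1).det = 0) :
    Module.rank ℂ (eigenspace 3 ((w : ℂ) ^ 6)) = 1 := by
  refine rank_eigenspace_eq_one (ε := 1) (i := 0)
    (exists_isSolution_of_det_eq_zero hw (Or.inl rfl) h1) fun u hu h0 x hx => ?_
  refine hu.eq_zero_of_endData hw ?_ (hu.endData_eq_zero (by norm_num)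
    (det_charMatrix_neg_one_ne_zero hw h1)) hx
  have hsin := (det_charMatrix_one_eq_zero_iff hw).1 h1
  have hS0 : hyp w (-1) 0 = 0 := by rw [hyp_neg_one_zero, hsin]; simp
  have hC0 : hyp w 1 0 ≠ 0 := by
    rw [hyp_one_zero]
    have : Real.cos (w / 2) ≠ 0 := by
      rcases Real.sin_eq_zero_iff_cos_eq.1 hsin with h | h <;> rw [h] <;> norm_num
    exact mul_ne_zero two_ne_zero (by exact_mod_cast this)
  have hM := hu.charMatrix_mulVec (ε := 1) (by norm_num)
  have m0 := congrFun hM 0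
  have m1 := congrFun hM 1
  -- As `hyp w (-1) 0 = 0`, row 0 kills the last coordinate; row 1 then kills the middle one.
  simp only [charMatrix, Matrix.mulVec, dotProduct, Fin.sum_univ_three, Matrix.of_apply,
    Matrix.cons_val, Pi.zero_apply, h0, hS0, mul_zero, zero_mul, zero_add, mul_eq_zero, hC0,
    false_or] at m0
  simp only [charMatrix, Matrix.mulVec, dotProduct, Fin.sum_univ_three, Matrix.of_apply,
    Matrix.cons_val, Pi.zero_apply, h0, m0, mul_zero, zero_add, add_zero, mul_eq_zero,
    charRoot_ne_zero hw, hyp_neg_one_one_ne_zero hw, false_or] at m1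
  ext i
  fin_cases i
  exacts [h0, m1, m0]

theorem rank_eigenspace_of_det_neg_one (hw : w ≠ 0) (h2 : (charMatrix w (-1)).det = 0) :
    Module.rank ℂ (eigenspace 3 ((w : ℂ) ^ 6)) = 1 := by
  have h1 : (charMatrix w 1).det ≠ 0 := fun h => det_charMatrix_neg_one_ne_zero hw h h2
  refine rank_eigenspace_eq_one (ε := -1) (i := 1)
    (exists_isSolution_of_det_eq_zero hw (Or.inr rfl) h2) fun u hu h0 x hx => ?_
  refine hu.eq_zero_of_endData hw (hu.endData_eq_zero (by norm_num) h1) ?_ hx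
  have hS0 : hyp w (-1) 0 ≠ 0 := by
    rw [hyp_neg_one_zero]
    have : Real.sin (w / 2) ≠ 0 := fun h => h1 ((det_charMatrix_one_eq_zero_iff hw).2 h)
    exact mul_ne_zero (by simp) (by exact_mod_cast this)
  have hM := hu.charMatrix_mulVec (ε := -1) (by norm_num)
  have m0 := congrFun hM 0
  have m1 := congrFun hM 1
  simp only [charMatrix, Matrix.mulVec, dotProduct, Fin.sum_univ_three, Matrix.of_apply,
    Matrix.cons_val, Pi.zero_apply, h0, mul_zero, add_zero] at m0 m1
  have a0 : charRoot w 0 ^ 2 * endData u (-1) 0 + endData u (-1) 2 = 0 :=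
    (mul_eq_zero.1 (by linear_combination m0 : hyp w (-1) 0 * _ = 0)).resolve_left hS0
  have a1 : charRoot w 1 ^ 2 * endData u (-1) 0 + endData u (-1) 2 = 0 :=
    (mul_eq_zero.1 (by linear_combination m1 : hyp w (-1) 1 * _ = 0)).resolve_left
      (hyp_neg_one_one_ne_zero hw)
  -- Rows 0 and 1 become two relations in two unknowns, independent because `r_0² ≠ r_1²`.
  have hX : endData u (-1) 0 = 0 := by
    refine (mul_eq_zero.1 (by linear_combination a1 - a0 :
      (charRoot w 1 ^ 2 - charRoot w 0 ^ 2) * _ = 0)).resolve_left ?_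
    have : charRoot w 1 ^ 2 - charRoot w 0 ^ 2 =
        charRoot w 0 ^ 2 * cubeRoot * (cubeRoot - cubeRoot ^ 2) := by
      simp only [charRoot, Fin.val_zero, Fin.val_one, pow_zero, pow_one, mul_one]
      linear_combination (Complex.I * w) ^ 2 * cubeRoot_pow_three
    rw [this, show cubeRoot - cubeRoot ^ 2 = cubeRoot * (1 - cubeRoot) by ring]
    exact mul_ne_zero (mul_ne_zero (pow_ne_zero _ (charRoot_ne_zero hw 0)) cubeRoot_ne_zero)
      (mul_ne_zero cubeRoot_ne_zero (sub_ne_zero.2 cubeRoot_ne_one.symm))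
  have hZ : endData u (-1) 2 = 0 := by rw [hX] at a0; simpa using a0
  ext i
  fin_cases i
  exacts [hX, h0, hZ]

end Rank

/-! ### Enumeration of the roots -/

theorem three_pi_div_two_le {m : ℕ} (hm : 1 ≤ m) :
    3 * Real.pi / 2 ≤ ((2 * m + 1 : ℕ) : ℝ) * Real.pi / 2 := by
  have : (1 : ℝ) ≤ m := by exact_mod_cast hm
  push_cast
  nlinarith [Real.pi_pos]

/-- The deviation `y` of half the `n`-th root from `n π / 2`, for `n = 2 m + 1`. -/
theorem exists_oddDev (m : ℕ) : ∃ y : ℝ, 1 ≤ m → y ∈ Ioo 0 (Real.pi / 6) ∧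
    oddChar (((2 * m + 1 : ℕ) : ℝ) * Real.pi / 2) ((-1) ^ (m + 1)) y = 2 := by
  by_cases hm : 1 ≤ m
  · obtain ⟨y, hy, h⟩ := exists_oddChar_eq_two (three_pi_div_two_le hm) (neg_one_pow_eq_or ℝ (m + 1))
    exact ⟨y, fun _ => ⟨hy, h⟩⟩
  · exact ⟨0, fun h => absurd h hm⟩

/-- A choice of the deviation given by `exists_oddDev`. -/
noncomputable def oddDev (m : ℕ) : ℝ := (exists_oddDev m).choose

theorem oddDev_mem {m : ℕ} (hm : 1 ≤ m) : oddDev m ∈ Ioo 0 (Real.pi / 6) :=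
  ((exists_oddDev m).choose_spec hm).1

theorem oddChar_oddDev {m : ℕ} (hm : 1 ≤ m) :
    oddChar (((2 * m + 1 : ℕ) : ℝ) * Real.pi / 2) ((-1) ^ (m + 1)) (oddDev m) = 2 :=
  ((exists_oddDev m).choose_spec hm).2

/-- The deviation of the `n`-th root from `n π`. -/
noncomputable def rootDev (n : ℕ) : ℝ :=
  if 3 ≤ n ∧ Odd n then 2 * (-1) ^ (n / 2 + 1) * oddDev (n / 2) else 0

/-- The positive sixth root of the `n`-th eigenvalue. -/
noncomputable def eigenRoot (n : ℕ) : ℝ := n * Real.pi + rootDev n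

theorem rootDev_of_even {n : ℕ} (hn : Even n) : rootDev n = 0 :=
  if_neg fun h => Nat.not_odd_iff_even.2 hn h.2

theorem rootDev_odd {m : ℕ} (hm : 1 ≤ m) :
    rootDev (2 * m + 1) = 2 * (-1) ^ (m + 1) * oddDev m := by
  rw [rootDev, if_pos ⟨by omega, odd_two_mul_add_one m⟩, show (2 * m + 1) / 2 = m by omega]

theorem rootDev_ne_zero {n : ℕ} (h3 : 3 ≤ n) (hn : Odd n) : rootDev n ≠ 0 := by
  obtain ⟨m, rfl⟩ := hn
  have hm : 1 ≤ m := by omega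
  rw [rootDev_odd hm]
  exact mul_ne_zero (mul_ne_zero two_ne_zero (pow_ne_zero _ (by norm_num))) (oddDev_mem hm).1.ne'

theorem abs_rootDev_lt (n : ℕ) : |rootDev n| < Real.pi / 3 := by
  by_cases h : 3 ≤ n ∧ Odd n
  · obtain ⟨h3, m, rfl⟩ := h
    have hm : 1 ≤ m := by omega
    rw [rootDev_odd hm, abs_mul, abs_mul, abs_pow, abs_neg, abs_one, one_pow,
      abs_of_pos (oddDev_mem hm).1, abs_two]
    linarith [(oddDev_mem hm).2]
  · rw [rootDev, if_neg h, abs_zero]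
    exact div_pos Real.pi_pos (by norm_num)

/-- Deviations below `π / 3` cannot reorder points spaced by `π`. The default deviation 0 at `n = 1`
makes this hold on all of `ℕ`. -/
theorem strictMono_eigenRoot : StrictMono eigenRoot := by
  refine strictMono_nat_of_lt_succ fun n => ?_
  have h1 := abs_lt.1 (abs_rootDev_lt n)
  have h2 := abs_lt.1 (abs_rootDev_lt (n + 1))
  unfold eigenRoot
  push_cast
  linarith [Real.pi_pos]

theorem eigenRoot_pos {n : ℕ} (hn : 1 ≤ n) : 0 < eigenRoot n := by
  have h : eigenRoot 0 = 0 := by simp [eigenRoot, rootDev]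
  rw [← h]
  exact strictMono_eigenRoot (by omega)

theorem eigenRoot_half_odd {m : ℕ} (hm : 1 ≤ m) :
    eigenRoot (2 * m + 1) / 2 =
      ((2 * m + 1 : ℕ) : ℝ) * Real.pi / 2 + (-1) ^ (m + 1) * oddDev m := by
  rw [eigenRoot, rootDev_odd hm]
  ring

theorem det_charMatrix_eigenRoot {n : ℕ} (hn : 2 ≤ n) :
    (charMatrix (eigenRoot n) 1).det = 0 ∨ (charMatrix (eigenRoot n) (-1)).det = 0 := by
  have hw := (eigenRoot_pos (by omega : 1 ≤ n)).ne'
  rw [det_charMatrix_one_eq_zero_iff hw, det_charMatrix_neg_one_eq_zero_iff hw]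
  rcases Nat.even_or_odd' n with ⟨m, rfl | rfl⟩
  · left
    rw [eigenRoot, rootDev_of_even (even_two_mul m), Real.sin_eq_zero_iff]
    exact ⟨m, by push_cast; ring⟩
  · right
    have hm : 1 ≤ m := by omega
    rw [eigenRoot_half_odd hm, ← oddChar_eq, oddChar_oddDev hm]

theorem exists_eigenRoot_eq {w : ℝ} (hw : 0 < w)
    (h : (charMatrix w 1).det = 0 ∨ (charMatrix w (-1)).det = 0) :
    ∃ n, 2 ≤ n ∧ eigenRoot n = w := by
  have hpi := Real.pi_pos
  rw [det_charMatrix_one_eq_zero_iff hw.ne', det_charMatrix_neg_one_eq_zero_iff hw.ne'] at h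
  rcases h with h | h
  · obtain ⟨k, hk⟩ := Real.sin_eq_zero_iff.1 h
    have hk0 : 0 < k := by
      by_contra! hle
      have : (k : ℝ) ≤ 0 := by exact_mod_cast hle
      nlinarith
    lift k to ℕ using hk0.le
    refine ⟨2 * k, by omega, ?_⟩
    rw [eigenRoot, rootDev_of_even (even_two_mul k)]
    push_cast at hk ⊢
    linarith
  · obtain ⟨m, hm, y, hy, hθ⟩ := exists_eq_of_cos_mul_eq_two (half_pos hw) h
    rw [hθ, ← oddChar_eq] at h
    have hd := oddDev_mem hm
    have : y = oddDev m := oddChar_eq_two_unique (three_pi_div_two_le hm)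
      (neg_one_pow_eq_or ℝ (m + 1)) hy ⟨hd.1, by linarith [hd.2]⟩ h (oddChar_oddDev hm)
    refine ⟨2 * m + 1, by omega, ?_⟩
    rw [this, ← eigenRoot_half_odd hm] at hθ
    linarith

/-! ### Completeness of the list and asymptotics -/

theorem rank_eigenspace_eigenRoot {n : ℕ} (hn : 2 ≤ n) :
    Module.rank ℂ (eigenspace 3 ((eigenRoot n : ℂ) ^ 6)) = 1 := by
  have hw := (eigenRoot_pos (by omega : 1 ≤ n)).ne'
  rcases det_charMatrix_eigenRoot hn with h | h
  exacts [rank_eigenspace_of_det_one hw h, rank_eigenspace_of_det_neg_one hw h]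

/-- Positivity reduces a complex `z` with a nonzero solution to `w ^ 6`, where an unlisted `w` has
both blocks invertible. -/
theorem rank_eigenspace_of_forall_ne {z : ℂ}
    (hz : ∀ n, 2 ≤ n → (eigenRoot n : ℂ) ^ 6 ≠ z) : Module.rank ℂ (eigenspace 3 z) = 0 := by
  by_cases hex : ∃ u, IsSolution 3 z u ∧ ∃ x ∈ Icc (0 : ℝ) 1, u x ≠ 0
  · obtain ⟨u, hu, hne⟩ := hex
    obtain ⟨t, ht, rfl⟩ := hu.exists_pos_of_ne_zero hne
    obtain ⟨w, hw, rfl⟩ : ∃ w : ℝ, 0 < w ∧ w ^ 6 = t :=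
      ⟨t ^ ((6 : ℕ) : ℝ)⁻¹, Real.rpow_pos_of_pos ht _, Real.rpow_inv_natCast_pow ht.le (by norm_num)⟩
    rw [Complex.ofReal_pow] at hz ⊢
    have hdet : ¬ ((charMatrix w 1).det = 0 ∨ (charMatrix w (-1)).det = 0) := by
      intro h
      obtain ⟨n, hn, h⟩ := exists_eigenRoot_eq hw h
      exact hz n hn (by rw [h])
    rw [not_or] at hdet
    exact rank_eigenspace_of_det_ne_zero hw.ne' hdet.1 hdet.2
  · push Not at hex
    exact rank_eigenspace_eq_zero hex

theorem strictMonoOn_eigenRoot_pow : StrictMonoOn (fun n => eigenRoot n ^ 6) (Ici 2) := by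
  intro a ha b _ hab
  rw [mem_Ici] at ha
  exact pow_lt_pow_left₀ (strictMono_eigenRoot hab) (eigenRoot_pos (by omega)).le (by norm_num)

theorem isEigenvalueSequence_eigenRoot :
    IsEigenvalueSequence 3 2 fun n => eigenRoot n ^ 6 where
  monotoneOn := strictMonoOn_eigenRoot_pow.monotoneOn
  count z := by
    by_cases h : ∃ n, 2 ≤ n ∧ (eigenRoot n : ℂ) ^ 6 = z
    · obtain ⟨n, hn, rfl⟩ := h
      rw [rank_eigenspace_eigenRoot hn, map_one, Set.encard_eq_one]
      refine ⟨n, ?_⟩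
      ext k
      simp only [mem_ofPred_eq, mem_singleton_iff]
      constructor
      · rintro ⟨hk, h⟩
        exact strictMonoOn_eigenRoot_pow.injOn hk hn (by exact_mod_cast h)
      · rintro rfl
        exact ⟨hn, by push_cast; rfl⟩
    · push Not at h
      rw [rank_eigenspace_of_forall_ne h, map_zero, Set.encard_eq_zero, eq_empty_iff_forall_notMem]
      rintro n ⟨hn, hz⟩
      exact h n hn (by rw [← hz]; push_cast; rfl)

/-- The deviation of `w` is twice that of `θ = w / 2`, which turns the constant 4 into 8. -/
theorem tendsto_rootDev :
    Tendsto (fun n : ℕ => rootDev n /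
        (8 * (-1 : ℝ) ^ (n / 2 + 1) * Real.exp (-(Real.pi * √3 / 2) * n)))
      (atTop ⊓ 𝓟 {n : ℕ | Odd n}) (𝓝 1) := by
  have hodd : ∀ᶠ n in atTop ⊓ 𝓟 {n : ℕ | Odd n}, Odd n :=
    (eventually_principal.2 fun _ h => h).filter_mono inf_le_right
  have h3 : ∀ᶠ n in atTop ⊓ 𝓟 {n : ℕ | Odd n}, 3 ≤ n :=
    (eventually_ge_atTop 3).filter_mono inf_le_left
  have key := tendsto_of_oddChar_eq_two (l := atTop ⊓ 𝓟 {n : ℕ | Odd n})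
    (a := fun n => (n : ℝ) * Real.pi / 2) (σ := fun n => (-1) ^ (n / 2 + 1))
    (y := fun n => oddDev (n / 2))
    (((tendsto_natCast_atTop_atTop.atTop_mul_const Real.pi_pos).atTop_div_const
      two_pos).mono_left inf_le_left)
    (Eventually.of_forall fun n => neg_one_pow_eq_or ℝ _)
    (h3.mono fun n hn => oddDev_mem (by omega))
    ((hodd.and h3).mono fun n hn => by
      obtain ⟨⟨m, rfl⟩, h3⟩ := hn
      rw [show (2 * m + 1) / 2 = m by omega]
      exact oddChar_oddDev (by omega))
  refine key.congr' ?_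
  filter_upwards [hodd, h3] with n hn h3
  have hs : ((-1 : ℝ)) ^ (n / 2 + 1) ≠ 0 := pow_ne_zero _ (by norm_num)
  rw [rootDev, if_pos ⟨h3, hn⟩,
    show -(Real.pi * √3 / 2) * (n : ℝ) = -(√3 * (n * Real.pi / 2)) by ring, Real.exp_neg]
  field_simp
  ring

theorem theorem1p1 :
    ∃ (lam δ : ℕ → ℝ),
      IsEigenvalueSequence 3 2 lam ∧
      StrictMonoOn lam (Ici 2) ∧
      (∀ n : ℕ, 2 ≤ n → Even n → lam n = (n * Real.pi) ^ 6) ∧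
      (∀ n : ℕ, 3 ≤ n → Odd n →
        lam n = (n * Real.pi + δ n) ^ 6 ∧ 0 < n * Real.pi + δ n ∧ δ n ≠ 0) ∧
      Tendsto
        (fun n : ℕ => δ n /
          (8 * (-1 : ℝ) ^ (n / 2 + 1) * Real.exp (-(Real.pi * √3 / 2) * n)))
        (atTop ⊓ 𝓟 {n : ℕ | Odd n}) (𝓝 1) ∧
      (∀ n : ℕ, 2 ≤ n → (lam n ^ (1 / 6 : ℝ) = n * Real.pi ↔ Even n)) := by
  refine ⟨fun n => eigenRoot n ^ 6, rootDev, isEigenvalueSequence_eigenRoot,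
    strictMonoOn_eigenRoot_pow, fun n _ hn => ?_, fun n h3 hn => ⟨rfl, eigenRoot_pos (by omega),
      rootDev_ne_zero h3 hn⟩, tendsto_rootDev, fun n hn => ?_⟩
  · simp only [eigenRoot, rootDev_of_even hn, add_zero]
  · have h : (fun n => eigenRoot n ^ 6) n ^ (1 / 6 : ℝ) = eigenRoot n := by
      have := Real.pow_rpow_inv_natCast (eigenRoot_pos (by omega : 1 ≤ n)).le
        (by norm_num : (6 : ℕ) ≠ 0)
      rwa [Nat.cast_ofNat, inv_eq_one_div] at this
    rw [h, eigenRoot, add_eq_left]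
    refine ⟨fun h0 => ?_, rootDev_of_even⟩
    by_contra hne
    have hodd := Nat.not_even_iff_odd.1 hne
    exact rootDev_ne_zero (by obtain ⟨m, rfl⟩ := hodd; omega) hodd h0
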